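/- **Theorem 1.2 (Failure of the Calderón–Zygmund a priori estimate).** Let $0<\theta<1$, let $\mathbb{B}^2=\{x\in\mathbb{R}^2:|x|<1\}$, and let $A:\mathbb{R}^2\to\mathbb{R}^2$ be given by $$A(\eta)=\big((1+\sqrt{\theta}\sin(\pi\eta_1))\,\eta_1,\ (1+\sqrt{\theta}\sin(\pi\eta_2))\,\eta_2\big),\qquad \eta=(\eta_1,\eta_2).$$ Put $$\bar q:=\sup_{L\in\{2,4,6,\dots\}}\left(1-\frac{1}{1+L}+\frac{1}{1+L(1-\theta)}\right).$$ Then for every $\Lambda>0$ and every $r\in(1,\bar q)$ there exist a Lipschitz function $u\in W^{1,\infty}_0(\mathbb{B}^2)$ (that is, $u\in W^{1,\infty}(\mathbb{B}^2)$, $u$ is continuous on $\overline{\mathbb{B}^2}$ and $u=0$ on $\partial\mathbb{B}^2$) and $F\in L^\infty(\mathbb{B}^2,\mathbb{R}^2)$ such that $$\operatorname{div}(A(\nabla u))=\operatorname{div}F\quad\text{in }\mathbb{B}^2,\qquad u=0\quad\text{on }\partial\mathbb{B}^2,$$ where the equation holds in the sense of distributions, i.e. $\int_{\mathbb{B}^2}\langle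 A(\nabla u),\nabla\varphi\rangle\,dx=\int_{\mathbb{B}^2}\langle F,\nabla\varphi\rangle\,dx$ for all $\varphi\in C_c^\infty(\mathbb{B}^2)$, but $$\int_{\mathbb{B}^2}|\nabla u|^r\,dx>\Lambda\left(1+\int_{\mathbb{B}^2}|F|^r\,dx\right).$$ -/

import Mathlib

open MeasureTheory TopologicalSpace
open scoped ENNReal Distributions Gradient RealInnerProductSpace

noncomputable section

/-- The Euclidean plane `ℝ²`. -/
abbrev Plane : Type := EuclideanSpace ℝ (Fin 2)

/-- The open unit disc `𝔹²`. -/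
def unitDisc : Opens Plane := ⟨Metric.ball 0 1, Metric.isOpen_ball⟩

/-- The nonlinear map `A(η) = ((1 + √θ sin(π η₁)) η₁, (1 + √θ sin(π η₂)) η₂)`. -/
def oscField (θ : ℝ) (η : Plane) : Plane :=
  !₂[(1 + Real.sqrt θ * Real.sin (Real.pi * η 0)) * η 0,
     (1 + Real.sqrt θ * Real.sin (Real.pi * η 1)) * η 1]

/-- The values `1 - 1/(1+L) + 1/(1+L(1-θ))` for positive even integers `L`. -/
def exponentValues (θ : ℝ) : Set ℝ :=
  {s | ∃ L : ℕ, 0 < L ∧ Even L ∧ s = 1 - 1 / (1 + (L : ℝ)) + 1 / (1 + (L : ℝ) * (1 - θ))}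

/-- The threshold exponent `q̄`, the supremum of the above values. -/
def thresholdExponent (θ : ℝ) : ℝ := sSup (exponentValues θ)

/-- For `0 < θ < 1` the threshold exponent is a genuine supremum (no junk value). -/
theorem isLUB_thresholdExponent {θ : ℝ} (h1 : θ < 1) :
    IsLUB (exponentValues θ) (thresholdExponent θ) := by
  apply isLUB_csSup
  · exact ⟨_, 2, by norm_num, by decide, rfl⟩
  · refine ⟨2, ?_⟩
    rintro s ⟨L, -, -, rfl⟩
    have hL : (0 : ℝ) ≤ (L : ℝ) := Nat.cast_nonneg L
    have a : 0 ≤ 1 / (1 + (L : ℝ)) := by positivity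
    have b : 1 / (1 + (L : ℝ) * (1 - θ)) ≤ 1 := by
      have : 0 ≤ (L : ℝ) * (1 - θ) := mul_nonneg hL (by linarith)
      rw [div_le_one (by linarith)]
      linarith
    linarith

/-- `G` is the weak (distributional) gradient of `u` on the open set `Ω`:
`∫_Ω u ∇φ = - ∫_Ω φ G` for all `φ ∈ C_c^∞(Ω)`. It is unique up to null sets. -/
structure HasWeakGradient (Ω : Opens Plane) (u : Plane → ℝ) (G : Plane → Plane) : Prop where
  locallyIntegrable : LocallyIntegrableOn u (Ω : Set Plane) volume
  locallyIntegrable_grad : LocallyIntegrableOn G (Ω : Set Plane) volume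
  integral_eq : ∀ φ : 𝓓(Ω, ℝ),
    ∫ x in (Ω : Set Plane), u x • ∇ (φ : Plane → ℝ) x = - ∫ x in (Ω : Set Plane), φ x • G x

/-- `div V = div F` in the sense of distributions on `Ω`:
`∫_Ω ⟨V, ∇φ⟩ = ∫_Ω ⟨F, ∇φ⟩` for all `φ ∈ C_c^∞(Ω)`. -/
structure DivEqDiv (Ω : Opens Plane) (V F : Plane → Plane) : Prop where
  locallyIntegrable_left : LocallyIntegrableOn V (Ω : Set Plane) volume
  locallyIntegrable_right : LocallyIntegrableOn F (Ω : Set Plane) volume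
  integral_eq : ∀ φ : 𝓓(Ω, ℝ),
    ∫ x in (Ω : Set Plane), ⟪V x, ∇ (φ : Plane → ℝ) x⟫ =
      ∫ x in (Ω : Set Plane), ⟪F x, ∇ (φ : Plane → ℝ) x⟫

/-- `u ∈ W^{1,∞}(Ω)` with weak gradient `∇u = G`. -/
structure MemW1Infty (Ω : Opens Plane) (u : Plane → ℝ) (G : Plane → Plane) : Prop where
  hasWeakGradient : HasWeakGradient Ω u G
  memLp : MemLp u ∞ (volume.restrict (Ω : Set Plane))
  memLp_grad : MemLp G ∞ (volume.restrict (Ω : Set Plane))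

/-- `u ∈ W^{1,∞}_0(Ω)` with weak gradient `∇u = G`: `u ∈ W^{1,∞}(Ω)`, and `u` (its continuous
representative) is continuous up to the boundary and vanishes there. -/
structure MemW1InftyZero (Ω : Opens Plane) (u : Plane → ℝ) (G : Plane → Plane) : Prop
    extends MemW1Infty Ω u G where
  continuousOn : ContinuousOn u (closure (Ω : Set Plane))
  eq_zero : ∀ x ∈ frontier (Ω : Set Plane), u x = 0

end

open MeasureTheory TopologicalSpace
open scoped ENNReal Distributions Gradient RealInnerProductSpace

noncomputable section

/-! The counterexample is a staircase laminate, built by convex integration. Seek `u` and a stream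
function `w` such that `A(∇u) = rot ∇w` off a small set. Since `rot ∇w` is divergence free, `F =
A(∇u) - rot ∇w` has the divergence of `A(∇u)`, and it lives on that small set.

Only states `∇u = (x, 0)`, `rot ∇w = (y, 0)` are split. Such a state is good when `y = a(x)`, with
`a = oscScalar θ`. Oscillating `u` in the first direction splits `x` with `y` fixed, and oscillating
`w` in the second splits `y` with `x` fixed (`exists_two_valued_gradient`). Put `k = 1 - √θ`. Then
`a(n) = n` at integers, while `a(-t) = -k t` for `t = j + 1/2` with `j` even. From the bad state
`(-(L n + 1/2), n)`, a horizontal split gives the good state `(n, n)` and the bad one `(-x', n)`,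
with `x' = L (n + 1) + 1/2`. A vertical split of the latter gives the good state `(-x', -k x')` and
the next bad state `(-x', n + 1)`. One round multiplies the bad measure by about `1 - q / n`, where
`q = 1 - 1/(1+L) + 1/(1+L k)`, so at height `n` it is of order `n ^ (-q)` (`staircaseState_nat`).

On the bad set `|F|` is of order `n`, so its share of `∫ |F| ^ r` is of order `n ^ (r - q)` and
tends to `0` for `r < q`. Starting at height `M` keeps `|∇u| ≥ M` on most of the disc, and `M` is as
large as desired. As `θ ≤ √θ`, the rates `q` reach every exponent below the threshold. -/

/-! ### Profiles on the circle and random phases -/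

/-- A continuous profile on the circle with prescribed mean which takes the values `0` and `1`
outside a set of small measure. -/
theorem exists_circle_profile {l δ : ℝ} (hl0 : 0 ≤ l) (hl1 : l ≤ 1) (hδ : 0 < δ) :
    ∃ p : UnitAddCircle → ℝ, Continuous p ∧ (∀ t, p t ∈ Set.Icc (0 : ℝ) 1) ∧ ∫ t, p t = l ∧
      volume {t | p t ≠ 0 ∧ p t ≠ 1} ≤ ENNReal.ofReal δ := by
  set τ := δ / 2 with hτ
  have hτ0 : 0 < τ := by positivity
  -- A plateau of height `1` on `‖t‖ ≤ c - τ`, falling linearly to `0` at `‖t‖ = c`. Its mean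
  -- depends continuously on `c` and runs from `0` to `1`, so some `c` gives mean `l`. The
  -- transition region has measure at most `2 τ = δ`.
  let P : ℝ → UnitAddCircle → ℝ := fun c t => max 0 (min 1 ((c - ‖t‖) / τ))
  have hPc : Continuous (Function.uncurry P) := by
    simp only [P, Function.uncurry_def]
    fun_prop
  have hI : Continuous fun c => ∫ t, P c t := by
    have := continuous_parametric_integral_of_continuous (μ := (volume : Measure UnitAddCircle))
      hPc isCompact_univ
    simpa using this
  have h0 : ∫ t, P 0 t = 0 := by
    have : P 0 = fun _ => 0 := by
      funext t
      have : (0 - ‖t‖) / τ ≤ 0 := div_nonpos_of_nonpos_of_nonneg (by simp) hτ0.le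
      exact max_eq_left ((min_le_right _ _).trans this)
    simp [this]
  have h1 : ∫ t, P (1 / 2 + τ) t = 1 := by
    have : P (1 / 2 + τ) = fun _ => 1 := by
      funext t
      have ht : ‖t‖ ≤ 1 / 2 := by
        have := AddCircle.norm_le_half_period (1 : ℝ) (x := t) one_ne_zero
        simpa using this
      have : 1 ≤ (1 / 2 + τ - ‖t‖) / τ := by
        rw [le_div_iff₀ hτ0]; linarith
      simp only [P]
      rw [min_eq_left this]
      norm_num
    rw [this]
    simp [measureReal_def]
  obtain ⟨c, -, hc⟩ := intermediate_value_Icc (show (0 : ℝ) ≤ 1 / 2 + τ by positivity)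
    hI.continuousOn (show l ∈ Set.Icc _ _ by simp only [h0, h1]; exact ⟨hl0, hl1⟩)
  refine ⟨P c, hPc.comp (by fun_prop : Continuous fun t => (c, t)), fun t => ⟨le_max_left _ _,
    max_le zero_le_one (min_le_left _ _)⟩, hc, ?_⟩
  have hsub : {t | P c t ≠ 0 ∧ P c t ≠ 1} ⊆
      Metric.closedBall (0 : UnitAddCircle) c \ Metric.closedBall 0 (c - τ) := by
    rintro t ⟨ht0, ht1⟩
    simp only [Set.mem_sdiff, mem_closedBall_zero_iff]
    constructor
    · by_contra! h
      apply ht0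
      have : (c - ‖t‖) / τ ≤ 0 := div_nonpos_of_nonpos_of_nonneg (by linarith) hτ0.le
      exact max_eq_left ((min_le_right _ _).trans this)
    · intro h
      apply ht1
      have : 1 ≤ (c - ‖t‖) / τ := by
        rw [le_div_iff₀ hτ0]; linarith
      simp only [P]
      rw [min_eq_left this]
      norm_num
  refine (measure_mono hsub).trans ?_
  rw [measure_sdiff (Metric.closedBall_subset_closedBall (by linarith))
    Metric.isClosed_closedBall.measurableSet.nullMeasurableSet (measure_ne_top _ _),
    AddCircle.volume_closedBall, AddCircle.volume_closedBall, tsub_le_iff_right]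
  -- When `c < τ` the inner ball is empty and `ENNReal.ofReal` truncates its measure to `0`. The
  -- outer ball alone then has measure at most `2 c < δ`.
  by_cases hneg : 0 ≤ min 1 (2 * (c - τ))
  · rw [← ENNReal.ofReal_add hδ.le hneg]
    apply ENNReal.ofReal_le_ofReal
    rcases min_cases 1 (2 * (c - τ)) with h | h <;> rcases min_cases 1 (2 * c) with h' | h' <;>
      linarith
  · refine le_add_right (ENNReal.ofReal_le_ofReal ?_)
    push Not at hneg
    rcases min_cases 1 (2 * (c - τ)) with h | h <;> rcases min_cases 1 (2 * c) with h' | h' <;>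
      linarith

/-- A continuous function of mean zero on the circle has a bounded periodic primitive. -/
theorem exists_bounded_primitive {g : UnitAddCircle → ℝ} (hg : Continuous g)
    (h0 : ∫ t, g t = 0) :
    ∃ (S : ℝ → ℝ) (B : ℝ), (∀ t : ℝ, HasDerivAt S (g t) t) ∧ ∀ t, |S t| ≤ B := by
  have hgc : Continuous fun t : ℝ => g t := hg.comp (AddCircle.continuous_mk' 1)
  have hd : ∀ t : ℝ, HasDerivAt (fun t : ℝ => ∫ y in (0 : ℝ)..t, g y) (g t) t := fun t =>
    intervalIntegral.integral_hasDerivAt_right (hgc.intervalIntegrable _ _)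
      (hgc.stronglyMeasurableAtFilter _ _) hgc.continuousAt
  have hper : Function.Periodic (fun t : ℝ => ∫ y in (0 : ℝ)..t, g y) 1 := by
    intro t
    have h1 := UnitAddCircle.intervalIntegral_preimage t g
    rw [h0] at h1
    simp only
    rw [← intervalIntegral.integral_add_adjacent_intervals (hgc.intervalIntegrable 0 t)
      (hgc.intervalIntegrable t (t + 1)), h1, add_zero]
  have hSc : Continuous (fun t : ℝ => ∫ y in (0 : ℝ)..t, g y) :=
    continuous_iff_continuousAt.2 fun t => (hd t).continuousAt
  obtain ⟨B, hB⟩ := (isCompact_Icc (a := (0 : ℝ)) (b := 1)).exists_bound_of_continuousOn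
    hSc.continuousOn
  refine ⟨_, B, hd, fun t => ?_⟩
  obtain ⟨y, hy, hy'⟩ := hper.exists_mem_Ico₀ one_pos t
  rw [hy']
  exact hB y ⟨hy.1, hy.2.le⟩

/-- Averaging over all phases: some phase does not exceed the mean. -/
theorem exists_phase_lintegral_le {α : Type*} [MeasurableSpace α] (μ : Measure α) [SFinite μ]
    {f : α → UnitAddCircle} (hf : Measurable f) {φ : UnitAddCircle → ℝ≥0∞} (hφ : Measurable φ) :
    ∃ s, ∫⁻ x, φ (f x + s) ∂μ ≤ (∫⁻ t, φ t) * μ Set.univ := by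
  have hm : Measurable fun z : UnitAddCircle × α => φ (f z.2 + z.1) :=
    hφ.comp ((hf.comp measurable_snd).add measurable_fst)
  have : IsProbabilityMeasure (volume : Measure UnitAddCircle) := ⟨by simp⟩
  obtain ⟨s, hs⟩ := exists_le_lintegral (μ := (volume : Measure UnitAddCircle))
    (f := fun s => ∫⁻ x, φ (f x + s) ∂μ) (hm.lintegral_prod_right').aemeasurable
  refine ⟨s, hs.trans (le_of_eq ?_)⟩
  rw [lintegral_lintegral_swap hm.aemeasurable]
  simp_rw [lintegral_add_left_eq_self φ]
  rw [lintegral_const]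

/-- `C¹` cutoffs between a compact set and an open neighbourhood of it. -/
theorem exists_contDiff_cutoff {E : Type*} [NormedAddCommGroup E] [NormedSpace ℝ E]
    [FiniteDimensional ℝ E] {K U : Set E} (hK : IsCompact K) (hU : IsOpen U) (h : K ⊆ U) :
    ∃ χ : E → ℝ, ContDiff ℝ 1 χ ∧ HasCompactSupport χ ∧ tsupport χ ⊆ U ∧
      (∀ x, χ x ∈ Set.Icc (0 : ℝ) 1) ∧ ∀ x ∈ K, χ =ᶠ[nhds x] fun _ => 1 := by
  obtain ⟨L, hL, hKL, hLU⟩ := exists_compact_between hK hU h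
  obtain ⟨f, h1, h0, hf⟩ := exists_contMDiffMap_one_nhds_of_subset_interior
    (n := 1) (modelWithCornersSelf ℝ E) hK.isClosed hKL
  have hsupp : tsupport (f : E → ℝ) ⊆ L :=
    closure_minimal (fun x hx => by_contra fun hn => hx (h0 x hn)) hL.isClosed
  refine ⟨f, f.contMDiff.contDiff, hL.of_isClosed_subset (isClosed_tsupport _) hsupp,
    hsupp.trans hLU, hf, fun x hx => ?_⟩
  exact (Filter.Eventually.filter_mono (nhds_le_nhdsSet hx) h1)

/-- For a random phase, a profile composed with a circle-valued map takes the value `1` on at most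
the expected proportion of the space, and intermediate values almost never. -/
theorem exists_profile_phase {α : Type*} [MeasurableSpace α] (μ : Measure α) [IsFiniteMeasure μ]
    {l ε : ℝ} (hl0 : 0 ≤ l) (hl1 : l ≤ 1) (hε : 0 < ε) :
    ∃ p : UnitAddCircle → ℝ, Continuous p ∧ (∀ t, p t ∈ Set.Icc (0 : ℝ) 1) ∧ ∫ t, p t = l ∧
      ∀ f : α → UnitAddCircle, Measurable f → ∃ s,
        μ.real {x | p (f x + s) = 1} ≤ l * μ.real Set.univ + ε ∧
        μ.real {x | p (f x + s) ≠ 0 ∧ p (f x + s) ≠ 1} ≤ ε := by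
  set V := μ.real Set.univ with hV
  have hV0 : 0 ≤ V := measureReal_nonneg
  set c := 2 * (V + 1) / ε + 1 with hc
  have hc1 : 1 ≤ c := by rw [hc, le_add_iff_nonneg_left]; positivity
  have hc0 : 0 < c := by linarith
  have hVc : V ≤ ε / 2 * c := by
    have : ε / 2 * c = (V + 1) + ε / 2 := by rw [hc]; field_simp
    linarith
  set δ := ε / (2 * c * (V + 1)) with hδ
  have hδ0 : 0 < δ := by positivity
  have hcδ : c * δ * V ≤ ε / 2 := by
    have : c * δ * (V + 1) = ε / 2 := by rw [hδ]; field_simp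
    nlinarith [mul_pos hc0 hδ0]
  obtain ⟨p, hp, hp01, hpl, hpδ⟩ := exists_circle_profile hl0 hl1 hδ0
  refine ⟨p, hp, hp01, hpl, fun f hf => ?_⟩
  set P : Set UnitAddCircle := {t | p t = 1} with hP
  set R : Set UnitAddCircle := {t | p t ≠ 0 ∧ p t ≠ 1} with hR
  have hPm : MeasurableSet P := hp.measurable (measurableSet_singleton 1)
  have hRm : MeasurableSet R :=
    (hp.measurable (measurableSet_singleton 0)).compl.inter hPm.compl
  have hPl : volume P ≤ ENNReal.ofReal l := by
    rw [← hpl, ofReal_integral_eq_lintegral_ofReal (hp.integrable_of_hasCompactSupport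
      (HasCompactSupport.of_compactSpace _)) (Filter.Eventually.of_forall fun t => (hp01 t).1)]
    rw [← lintegral_indicator_one hPm]
    refine lintegral_mono fun t => ?_
    by_cases ht : t ∈ P
    · have : p t = 1 := ht
      simp [ht, this]
    · simp [ht]
  -- One phase must control both sets, so they enter a single average. The weight `c` is so large
  -- that a bound on the sum makes the `R` part small, while `δ` is so small that `c * δ` barely
  -- raises the mean above `l`.
  let φ : UnitAddCircle → ℝ≥0∞ := fun t => P.indicator 1 t + ENNReal.ofReal c * R.indicator 1 t
  have hφ : Measurable φ := (measurable_one.indicator hPm).add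
    ((measurable_one.indicator hRm).const_mul _)
  obtain ⟨s, hs⟩ := exists_phase_lintegral_le μ hf hφ
  have hfs : Measurable fun x => f x + s := hf.add_const s
  have h1 : ∫⁻ t, φ t ≤ ENNReal.ofReal (l + c * δ) := by
    rw [lintegral_add_left (measurable_one.indicator hPm),
      lintegral_const_mul _ (measurable_one.indicator hRm), lintegral_indicator_one hPm,
      lintegral_indicator_one hRm, ENNReal.ofReal_add hl0 (by positivity),
      ENNReal.ofReal_mul hc0.le]
    gcongr
  have h2 : ∫⁻ x, φ (f x + s) ∂μ = μ {x | f x + s ∈ P} + ENNReal.ofReal c * μ {x | f x + s ∈ R} := by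
    simp only [φ]
    have mP : Measurable fun x => P.indicator (1 : UnitAddCircle → ℝ≥0∞) (f x + s) :=
      (measurable_one.indicator hPm).comp hfs
    have mR : Measurable fun x => R.indicator (1 : UnitAddCircle → ℝ≥0∞) (f x + s) :=
      (measurable_one.indicator hRm).comp hfs
    rw [lintegral_add_left mP, lintegral_const_mul _ mR]
    congr 1
    · exact lintegral_indicator_one (hfs hPm)
    · congr 1
      exact lintegral_indicator_one (hfs hRm)
  rw [h2] at hs
  have h3 := hs.trans (mul_le_mul_left h1 _)
  have h4 := ENNReal.toReal_mono (by finiteness) h3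
  rw [ENNReal.toReal_add (by finiteness) (by finiteness), ENNReal.toReal_mul, ENNReal.toReal_mul,
    ENNReal.toReal_ofReal hc0.le, ENNReal.toReal_ofReal (by positivity)] at h4
  change μ.real {x | f x + s ∈ P} + c * μ.real {x | f x + s ∈ R} ≤ (l + c * δ) * V at h4
  have hp0 : 0 ≤ μ.real {x | f x + s ∈ P} := measureReal_nonneg
  have hr0 : 0 ≤ μ.real {x | f x + s ∈ R} := measureReal_nonneg
  refine ⟨s, ?_, ?_⟩
  · change μ.real {x | f x + s ∈ P} ≤ _
    have : 0 ≤ c * μ.real {x | f x + s ∈ R} := by positivity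
    linarith
  · change μ.real {x | f x + s ∈ R} ≤ _
    have h5 : c * μ.real {x | f x + s ∈ R} ≤ c * ε := by
      have : l * V ≤ V := mul_le_of_le_one_left hV0 hl1
      have : ε / 2 ≤ ε / 2 * c := le_mul_of_one_le_right (by positivity) hc1
      linarith
    exact le_of_mul_le_mul_left h5 hc0

/-! ### Gradients and localized oscillations -/

theorem gradient_add_of_contDiff {E : Type*} [NormedAddCommGroup E] [InnerProductSpace ℝ E]
    [CompleteSpace E] {u v : E → ℝ} (hu : ContDiff ℝ 1 u) (hv : ContDiff ℝ 1 v) (x : E) :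
    ∇ (fun y => u y + v y) x = ∇ u x + ∇ v x := by
  simp only [gradient]
  rw [fderiv_fun_add (hu.differentiable one_ne_zero x) (hv.differentiable one_ne_zero x), map_add]

theorem norm_gradient {E : Type*} [NormedAddCommGroup E] [InnerProductSpace ℝ E]
    [CompleteSpace E] (u : E → ℝ) (x : E) : ‖∇ u x‖ = ‖fderiv ℝ u x‖ := by
  simp [gradient]

theorem continuous_gradient {E : Type*} [NormedAddCommGroup E] [InnerProductSpace ℝ E]
    [CompleteSpace E] {u : E → ℝ} (hu : ContDiff ℝ 1 u) : Continuous (∇ u) :=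
  (InnerProductSpace.toDual ℝ E).symm.continuous.comp (hu.continuous_fderiv one_ne_zero)

theorem hasGradientAt_coord {ι : Type*} [Fintype ι] [DecidableEq ι] (i : ι)
    (x : EuclideanSpace ℝ ι) :
    HasGradientAt (fun y : EuclideanSpace ℝ ι => y i) (EuclideanSpace.single i 1) x := by
  rw [hasGradientAt_iff_hasFDerivAt]
  refine (EuclideanSpace.proj (𝕜 := ℝ) i).hasFDerivAt.congr_fderiv ?_
  ext y
  simp [EuclideanSpace.inner_single_left]

/-- A modulated fast oscillation in a coordinate direction and its gradient. -/
theorem hasGradientAt_oscillation {ι : Type*} [Fintype ι] [DecidableEq ι] (i : ι)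
    {χ : EuclideanSpace ℝ ι → ℝ} (hχ : ContDiff ℝ 1 χ) {S g : ℝ → ℝ}
    (hS : ∀ t, HasDerivAt S (g t) t) {n : ℝ} (hn : n ≠ 0) (s : ℝ) (x : EuclideanSpace ℝ ι) :
    HasGradientAt (fun y => χ y * (n⁻¹ * S (n * y i + s)))
      (EuclideanSpace.single i (χ x * g (n * x i + s)) + (n⁻¹ * S (n * x i + s)) • ∇ χ x) x := by
  have h1 := ((hasGradientAt_coord i x).hasFDerivAt.const_mul n).add_const s
  have h2 := ((hS (n * x i + s)).comp_hasFDerivAt x h1).const_mul n⁻¹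
  have h3 := ((hχ.differentiable one_ne_zero x).hasFDerivAt.mul h2)
  rw [hasGradientAt_iff_hasFDerivAt]
  refine h3.congr_fderiv ?_
  ext y
  simp [EuclideanSpace.inner_single_left]
  field_simp

/-- Oscillation lemma: on most of a given set the gradient takes two prescribed values. -/
theorem exists_two_valued_gradient {ι : Type*} [Fintype ι] [DecidableEq ι]
    {Ω E : Set (EuclideanSpace ℝ ι)} (hΩ : IsOpen Ω) (hΩv : volume Ω ≠ ⊤)
    (hE : MeasurableSet E) (hEΩ : E ⊆ Ω) (i : ι) {a b l ε : ℝ} (hl0 : 0 ≤ l) (hl1 : l ≤ 1)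
    (hab : l * a + (1 - l) * b = 0) (hε : 0 < ε) :
    ∃ (v : EuclideanSpace ℝ ι → ℝ) (E₁ E₂ D : Set (EuclideanSpace ℝ ι)),
      ContDiff ℝ 1 v ∧ HasCompactSupport v ∧ tsupport v ⊆ Ω ∧
      (∀ x, ‖∇ v x‖ ≤ |a| + |b| + 1) ∧
      MeasurableSet E₁ ∧ MeasurableSet D ∧ E₁ ⊆ E ∧ E₂ ⊆ E ∧ D ⊆ Ω ∧
      E ⊆ E₁ ∪ E₂ ∪ D ∧
      volume.real D ≤ ε ∧ volume.real E₁ ≤ l * volume.real E + ε ∧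
      (∀ x ∈ E₁, ∇ v x = EuclideanSpace.single i a) ∧
      (∀ x ∈ E₂, ∇ v x = EuclideanSpace.single i b) ∧
      ∀ x ∉ E₁ ∪ E₂ ∪ D, ∇ v x = 0 := by
  have hEv : volume E ≠ ⊤ := ne_top_of_le_ne_top hΩv (measure_mono hEΩ)
  have hε4 : ENNReal.ofReal (ε / 4) ≠ 0 := by simpa using hε
  -- The cutoff is `1` near `K` and supported in `U`, so it varies only inside `U \ K`, of measure
  -- at most `ε / 2`.
  obtain ⟨K, hKE, hK, hKε⟩ := hE.exists_isCompact_sdiff_lt hEv hε4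
  obtain ⟨U', hEU', hU', -, hUε⟩ := hE.exists_isOpen_sdiff_lt hEv hε4
  set U := U' ∩ Ω with hUdef
  have hU : IsOpen U := hU'.inter hΩ
  have hEU : E ⊆ U := Set.subset_inter hEU' hEΩ
  obtain ⟨χ, hχ, hχc, hχU, hχ01, hχ1⟩ := exists_contDiff_cutoff hK hU (hKE.trans hEU)
  have hχK : ∀ x ∈ K, χ x = 1 ∧ ∇ χ x = 0 := fun x hx => by
    refine ⟨(hχ1 x hx).eq_of_nhds, ?_⟩
    rw [(hχ1 x hx).gradient_eq]
    simp
  have hKfin : IsFiniteMeasure (volume.restrict K) := ⟨by simpa using hK.measure_lt_top⟩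
  obtain ⟨p, hp, hp01, hpl, hph⟩ := exists_profile_phase (volume.restrict K) hl0 hl1
    (show 0 < ε / 4 by positivity)
  let g : UnitAddCircle → ℝ := fun t => p t * a + (1 - p t) * b
  have hgc : Continuous g := by fun_prop
  have hg0 : ∫ t, g t = 0 := by
    have hpi : Integrable p := hp.integrable_of_hasCompactSupport
      (HasCompactSupport.of_compactSpace _)
    have : g = fun t => p t * (a - b) + b := by funext t; simp only [g]; ring
    rw [this, integral_add (hpi.mul_const _) (integrable_const _), integral_mul_const, hpl]
    simp [measureReal_def]
    linarith
  have hgb : ∀ t, |g t| ≤ |a| + |b| := fun t => by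
    have h := hp01 t
    calc |g t| ≤ |p t * a| + |(1 - p t) * b| := abs_add_le _ _
      _ = p t * |a| + (1 - p t) * |b| := by
        rw [abs_mul, abs_mul, abs_of_nonneg h.1, abs_of_nonneg (sub_nonneg.2 h.2)]
      _ ≤ |a| + |b| := add_le_add (mul_le_of_le_one_left (abs_nonneg a) h.2)
        (mul_le_of_le_one_left (abs_nonneg b) (by linarith [h.1]))
  obtain ⟨S, B, hS, hSB⟩ := exists_bounded_primitive hgc hg0
  obtain ⟨C, hC⟩ := (hχc.fderiv (𝕜 := ℝ)).exists_bound_of_continuous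
    (hχ.continuous_fderiv one_ne_zero)
  have hB0 : 0 ≤ B := (abs_nonneg _).trans (hSB 0)
  have hC0 : 0 ≤ C := (norm_nonneg _).trans (hC 0)
  -- This fixed frequency makes the cutoff error `n⁻¹ S ∇χ` at most `1`. No limit in `n` is needed:
  -- the random phase supplies the volume fraction, and the error vanishes on `K`.
  set n : ℝ := B * C + 1 with hn
  have hn0 : 0 < n := by positivity
  have hfm : Measurable fun x : EuclideanSpace ℝ ι => ((n * x i : ℝ) : UnitAddCircle) := by
    have : Continuous fun x : EuclideanSpace ℝ ι => ((n * x i : ℝ) : UnitAddCircle) :=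
      (AddCircle.continuous_mk' 1).comp (by fun_prop)
    exact this.measurable
  obtain ⟨s', hs1, hs2⟩ := hph _ hfm
  obtain ⟨s, rfl⟩ := QuotientAddGroup.mk_surjective s'
  let q : EuclideanSpace ℝ ι → ℝ := fun x => p ((n * x i + s : ℝ) : UnitAddCircle)
  have hq : Continuous q := hp.comp ((AddCircle.continuous_mk' 1).comp (by fun_prop))
  have hs1' : (volume.restrict K).real {x | q x = 1} ≤ l * volume.real K + ε / 4 := by
    simpa [q] using hs1
  have hs2' : (volume.restrict K).real {x | q x ≠ 0 ∧ q x ≠ 1} ≤ ε / 4 := by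
    simpa [q] using hs2
  have hm1 : MeasurableSet {x | q x = 1} := hq.measurable (measurableSet_singleton 1)
  have hm2 : MeasurableSet {x | q x ≠ 0 ∧ q x ≠ 1} :=
    (hq.measurable (measurableSet_singleton 0)).compl.inter hm1.compl
  rw [measureReal_restrict_apply hm1] at hs1'
  rw [measureReal_restrict_apply hm2] at hs2'
  have hgrad := hasGradientAt_oscillation i hχ (g := fun t => g t) hS hn0.ne' s
  have htv : tsupport (fun y => χ y * (n⁻¹ * S (n * y i + s))) ⊆ tsupport χ :=
    tsupport_mul_subset_left
  have hvd : ContDiff ℝ 1 fun y => χ y * (n⁻¹ * S (n * y i + s)) := by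
    have : ContDiff ℝ 1 S := by
      rw [contDiff_one_iff_deriv]
      refine ⟨fun t => (hS t).differentiableAt, ?_⟩
      rw [show deriv S = fun t : ℝ => g t from funext fun t => (hS t).deriv]
      exact hgc.comp (AddCircle.continuous_mk' 1)
    have h2 : ContDiff ℝ 1 fun y : EuclideanSpace ℝ ι => n * y i + s := by fun_prop
    exact hχ.mul (contDiff_const.mul (this.comp h2))
  -- The exceptional set collects the region `U \ K` and the points of `K` where the profile is
  -- strictly between `0` and `1`.
  refine ⟨fun y => χ y * (n⁻¹ * S (n * y i + s)), {x | q x = 1} ∩ K, {x | q x = 0} ∩ K,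
    (U \ K) ∪ ({x | q x ≠ 0 ∧ q x ≠ 1} ∩ K), hvd, hχc.mul_right, htv.trans
    (hχU.trans Set.inter_subset_right), fun x => ?_, hm1.inter hK.measurableSet,
    (hU.measurableSet.diff hK.measurableSet).union (hm2.inter hK.measurableSet),
    Set.inter_subset_right.trans hKE, Set.inter_subset_right.trans hKE, ?_, ?_, ?_, ?_, ?_, ?_, ?_⟩
  · rw [(hgrad x).gradient]
    refine (norm_add_le _ _).trans (add_le_add ?_ ?_)
    · rw [PiLp.norm_single, norm_mul, Real.norm_eq_abs, Real.norm_eq_abs,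
        abs_of_nonneg (hχ01 x).1]
      exact (mul_le_of_le_one_left (abs_nonneg _) (hχ01 x).2).trans (hgb _)
    · rw [norm_smul, norm_gradient, norm_mul, norm_inv, Real.norm_eq_abs, Real.norm_eq_abs,
        abs_of_pos hn0, mul_assoc, inv_mul_le_iff₀ hn0, mul_one]
      exact (mul_le_mul (hSB _) (hC x) (norm_nonneg _) hB0).trans (by rw [hn]; linarith)
  · exact Set.union_subset (Set.sdiff_subset.trans Set.inter_subset_right)
      (Set.inter_subset_right.trans (hKE.trans hEΩ))
  · intro x hx
    by_cases hxK : x ∈ K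
    · by_cases h1 : q x = 1
      · exact Or.inl (Or.inl ⟨h1, hxK⟩)
      by_cases h0 : q x = 0
      · exact Or.inl (Or.inr ⟨h0, hxK⟩)
      · exact Or.inr (Or.inr ⟨⟨h0, h1⟩, hxK⟩)
    · exact Or.inr (Or.inl ⟨hEU hx, hxK⟩)
  · refine (measureReal_union_le _ _).trans ?_
    have h1 : volume.real (U \ K) ≤ ε / 4 + ε / 4 := by
      have hsub : U \ K ⊆ (U' \ E) ∪ (E \ K) := by
        rintro x ⟨hx, hxK⟩
        by_cases hxE : x ∈ E
        · exact Or.inr ⟨hxE, hxK⟩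
        · exact Or.inl ⟨hx.1, hxE⟩
      refine (measureReal_mono hsub (measure_union_ne_top hUε.ne_top hKε.ne_top)).trans ?_
      refine (measureReal_union_le _ _).trans (add_le_add ?_ ?_)
      · exact ENNReal.toReal_le_of_le_ofReal (by positivity) hUε.le
      · exact ENNReal.toReal_le_of_le_ofReal (by positivity) hKε.le
    linarith
  · have : volume.real K ≤ volume.real E := measureReal_mono hKE hEv
    nlinarith
  · rintro x ⟨hx1, hxK⟩
    have hx1 : p ((n * x i + s : ℝ) : UnitAddCircle) = 1 := hx1
    rw [(hgrad x).gradient, (hχK x hxK).1, (hχK x hxK).2]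
    simp only [g, hx1]
    simp
  · rintro x ⟨hx1, hxK⟩
    have hx1 : p ((n * x i + s : ℝ) : UnitAddCircle) = 0 := hx1
    rw [(hgrad x).gradient, (hχK x hxK).1, (hχK x hxK).2]
    simp only [g, hx1]
    simp
  · intro x hx
    have hxU : x ∉ U := by
      intro hxU
      apply hx
      by_cases hxK : x ∈ K
      · by_cases h1 : q x = 1
        · exact Or.inl (Or.inl ⟨h1, hxK⟩)
        by_cases h0 : q x = 0
        · exact Or.inl (Or.inr ⟨h0, hxK⟩)
        · exact Or.inr (Or.inr ⟨⟨h0, h1⟩, hxK⟩)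
      · exact Or.inr (Or.inl ⟨hxU, hxK⟩)
    have hxt : x ∉ tsupport χ := fun h => hxU (hχU h)
    have h0 : ∇ χ x = 0 := by
      rw [(notMem_tsupport_iff_eventuallyEq.1 hxt).gradient_eq]
      exact gradient_const _ _
    rw [(hgrad x).gradient, h0, image_eq_zero_of_notMem_tsupport hxt]
    simp

/-! ### Rotated gradients and weak formulations -/

/-- The rotation by a right angle, turning gradients into divergence free fields. -/
def quarterTurn (η : Plane) : Plane := !₂[η 1, -η 0]

theorem continuous_quarterTurn : Continuous quarterTurn := by
  unfold quarterTurn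
  fun_prop

theorem norm_quarterTurn (η : Plane) : ‖quarterTurn η‖ = ‖η‖ := by
  simp [EuclideanSpace.norm_eq, quarterTurn, Fin.sum_univ_two, add_comm]

theorem quarterTurn_single_one (t : ℝ) :
    quarterTurn (EuclideanSpace.single 1 t) = EuclideanSpace.single 0 t := by
  ext i
  fin_cases i <;> simp [quarterTurn]

theorem fderiv_apply_single {ι : Type*} [Fintype ι] [DecidableEq ι]
    (w : EuclideanSpace ℝ ι → ℝ) (x : EuclideanSpace ℝ ι) (i : ι) :
    fderiv ℝ w x (EuclideanSpace.single i 1) = (∇ w x) i := by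
  rw [← inner_gradient_left, EuclideanSpace.inner_single_right]
  simp

theorem testFunction_gradient_eq_zero {Ω : Opens Plane} (φ : 𝓓(Ω, ℝ)) {x : Plane}
    (hx : x ∉ (Ω : Set Plane)) : ∇ (φ : Plane → ℝ) x = 0 := by
  have hxt : x ∉ tsupport (φ : Plane → ℝ) := fun h => hx (φ.tsupport_subset h)
  rw [(notMem_tsupport_iff_eventuallyEq.1 hxt).gradient_eq]
  exact gradient_const _ _

theorem testFunction_eq_zero {Ω : Opens Plane} (φ : 𝓓(Ω, ℝ)) {x : Plane}
    (hx : x ∉ (Ω : Set Plane)) : φ x = 0 :=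
  image_eq_zero_of_notMem_tsupport fun h => hx (φ.tsupport_subset h)

theorem hasCompactSupport_gradient {u : Plane → ℝ} (hu : HasCompactSupport u) :
    HasCompactSupport (∇ u) := by
  refine hu.mono' fun x hx => ?_
  by_contra hxt
  apply hx
  rw [(notMem_tsupport_iff_eventuallyEq.1 hxt).gradient_eq]
  exact gradient_const _ _

/-- A `C¹` function has its classical gradient as weak gradient. -/
theorem hasWeakGradient_gradient (Ω : Opens Plane) {u : Plane → ℝ} (hu : ContDiff ℝ 1 u) :
    HasWeakGradient Ω u (∇ u) where
  locallyIntegrable := hu.continuous.locallyIntegrable.locallyIntegrableOn _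
  locallyIntegrable_grad := (continuous_gradient hu).locallyIntegrable.locallyIntegrableOn _
  integral_eq φ := by
    have hφ : ContDiff ℝ 1 (φ : Plane → ℝ) := φ.contDiff.of_le (by exact_mod_cast le_top)
    have hφc := φ.hasCompactSupport
    rw [setIntegral_eq_integral_of_forall_compl_eq_zero
        (fun x hx => by rw [testFunction_gradient_eq_zero φ hx, smul_zero]),
      setIntegral_eq_integral_of_forall_compl_eq_zero
        (fun x hx => by rw [testFunction_eq_zero φ hx, zero_smul])]
    have i1 : Integrable fun x => u x • ∇ (φ : Plane → ℝ) x :=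
      (hu.continuous.smul (continuous_gradient hφ)).integrable_of_hasCompactSupport
        ((hasCompactSupport_gradient hφc).smul_left)
    have i2 : Integrable fun x => φ x • ∇ u x :=
      (hφ.continuous.smul (continuous_gradient hu)).integrable_of_hasCompactSupport
        (hφc.smul_right)
    refine ext_inner_left ℝ fun v => ?_
    rw [inner_neg_right, ← integral_inner i1, ← integral_inner i2]
    have e1 : ∀ x, ⟪v, u x • ∇ (φ : Plane → ℝ) x⟫ = u x * fderiv ℝ φ x v := fun x => by
      rw [inner_smul_right, inner_gradient_right]; simp
    have e2 : ∀ x, ⟪v, φ x • ∇ u x⟫ = fderiv ℝ u x v * φ x := fun x => by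
      rw [inner_smul_right, inner_gradient_right, mul_comm]; simp
    have j1 := (innerSL ℝ v).integrable_comp i1
    have j2 := (innerSL ℝ v).integrable_comp i2
    simp only [innerSL_apply_apply, e1] at j1 ⊢
    simp only [innerSL_apply_apply, e2] at j2 ⊢
    exact integral_mul_fderiv_eq_neg_fderiv_mul_of_integrable j2 j1
      ((hu.continuous.mul hφ.continuous).integrable_of_hasCompactSupport hφc.mul_left)
      (fun x _ => hu.differentiable one_ne_zero x) (fun x _ => hφ.differentiable one_ne_zero x)

/-- The rotated gradient of a `C¹` function is weakly divergence free. -/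
theorem integral_inner_quarterTurn_gradient {Ω : Opens Plane} {w : Plane → ℝ}
    (hw : ContDiff ℝ 1 w) (φ : 𝓓(Ω, ℝ)) :
    ∫ x in (Ω : Set Plane), ⟪quarterTurn (∇ w x), ∇ (φ : Plane → ℝ) x⟫ = 0 := by
  have hφ2 : ContDiff ℝ 2 (φ : Plane → ℝ) :=
    φ.contDiff.of_le (WithTop.coe_le_coe.2 (le_top : (2 : ℕ∞) ≤ ⊤))
  have hφc := φ.hasCompactSupport
  rw [setIntegral_eq_integral_of_forall_compl_eq_zero
    (fun x hx => by rw [testFunction_gradient_eq_zero φ hx, inner_zero_right])]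
  let e : Fin 2 → Plane := fun i => EuclideanSpace.single i 1
  have hd : ∀ i, ContDiff ℝ 1 fun x => fderiv ℝ (φ : Plane → ℝ) x (e i) := fun i =>
    (hφ2.fderiv_right (by norm_num [one_add_one_eq_two])).clm_apply contDiff_const
  have hc : ∀ i, HasCompactSupport fun x => fderiv ℝ (φ : Plane → ℝ) x (e i) := fun i =>
    hφc.fderiv_apply ℝ (e i)
  have hcw : ∀ i, Continuous fun x => fderiv ℝ w x (e i) := fun i =>
    (hw.continuous_fderiv one_ne_zero).clm_apply continuous_const
  -- Since `w` is only `C¹`, its derivatives are moved onto `φ`, whose mixed second derivatives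
  -- agree.
  have key : ∀ i j, Integrable (fun x => fderiv ℝ w x (e i) * fderiv ℝ (φ : Plane → ℝ) x (e j)) ∧
      ∫ x, fderiv ℝ w x (e i) * fderiv ℝ (φ : Plane → ℝ) x (e j) =
        -∫ x, w x * fderiv ℝ (fun y => fderiv ℝ (φ : Plane → ℝ) y (e j)) x (e i) := by
    intro i j
    have h1 : Integrable (fun x => fderiv ℝ w x (e i) * fderiv ℝ (φ : Plane → ℝ) x (e j)) :=
      ((hcw i).mul (hd j).continuous).integrable_of_hasCompactSupport (hc j).mul_left
    refine ⟨h1, ?_⟩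
    rw [integral_mul_fderiv_eq_neg_fderiv_mul_of_integrable h1, neg_neg]
    · exact (hw.continuous.mul (((hd j).continuous_fderiv one_ne_zero).clm_apply
        continuous_const)).integrable_of_hasCompactSupport ((hc j).fderiv_apply ℝ (e i)).mul_left
    · exact (hw.continuous.mul (hd j).continuous).integrable_of_hasCompactSupport (hc j).mul_left
    · exact fun x _ => hw.differentiable one_ne_zero x
    · exact fun x _ => (hd j).differentiable one_ne_zero x
  have hsymm : ∀ x, fderiv ℝ (fun y => fderiv ℝ (φ : Plane → ℝ) y (e 0)) x (e 1) =
      fderiv ℝ (fun y => fderiv ℝ (φ : Plane → ℝ) y (e 1)) x (e 0) := fun x => by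
    have hdd : DifferentiableAt ℝ (fderiv ℝ (φ : Plane → ℝ)) x :=
      (hφ2.fderiv_right (m := 1) (by norm_num [one_add_one_eq_two])).differentiable one_ne_zero x
    have hs : IsSymmSndFDerivAt ℝ (φ : Plane → ℝ) x :=
      hφ2.contDiffAt.isSymmSndFDerivAt (by simp)
    rw [fderiv_clm_apply hdd (differentiableAt_const _),
      fderiv_clm_apply hdd (differentiableAt_const _)]
    simpa using hs (e 1) (e 0)
  have hexp : ∀ x, ⟪quarterTurn (∇ w x), ∇ (φ : Plane → ℝ) x⟫ =
      fderiv ℝ w x (e 1) * fderiv ℝ (φ : Plane → ℝ) x (e 0) -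
        fderiv ℝ w x (e 0) * fderiv ℝ (φ : Plane → ℝ) x (e 1) := fun x => by
    simp only [e, fderiv_apply_single]
    rw [PiLp.inner_apply]
    simp [quarterTurn, Fin.sum_univ_two]
    ring
  simp only [hexp]
  rw [integral_sub (key 1 0).1 (key 0 1).1, (key 1 0).2, (key 0 1).2]
  simp only [hsymm, sub_self]

/-! ### The oscillating field -/

theorem continuous_oscField (θ : ℝ) : Continuous (oscField θ) := by
  unfold oscField
  fun_prop

/-- The scalar profile of the oscillating field. -/
def oscScalar (θ t : ℝ) : ℝ := (1 + Real.sqrt θ * Real.sin (Real.pi * t)) * t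

theorem oscField_single_zero (θ t : ℝ) :
    oscField θ (EuclideanSpace.single 0 t) = EuclideanSpace.single 0 (oscScalar θ t) := by
  ext i
  fin_cases i <;> simp [oscField, oscScalar]

theorem norm_oscField_le {θ : ℝ} (hθ1 : θ ≤ 1) (η : Plane) : ‖oscField θ η‖ ≤ 2 * ‖η‖ := by
  have hs : Real.sqrt θ ≤ 1 := Real.sqrt_le_one.2 hθ1
  have hs0 := Real.sqrt_nonneg θ
  have hfac : ∀ t : ℝ, ((1 + Real.sqrt θ * Real.sin (Real.pi * t)) * t) ^ 2 ≤ (2 * t) ^ 2 := by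
    intro t
    rw [mul_pow, mul_pow]
    refine mul_le_mul_of_nonneg_right ?_ (sq_nonneg t)
    have h1 := Real.neg_one_le_sin (Real.pi * t)
    have h2 := Real.sin_le_one (Real.pi * t)
    apply sq_le_sq'
    · nlinarith
    · nlinarith
  rw [EuclideanSpace.norm_eq, Real.sqrt_le_left (by positivity), mul_pow,
    EuclideanSpace.norm_sq_eq]
  simp only [Fin.sum_univ_two, Real.norm_eq_abs, sq_abs, oscField]
  have a := hfac (η 0)
  have b := hfac (η 1)
  simp only [mul_pow] at a b ⊢
  simp
  linarith

/-! ### Staircase states and their splittings -/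

/-- Approximate staircase states: up to an exceptional set of measure `ε`, the pair `(∇u, ∇w)`
solves the differential inclusion `A(∇u) = rot ∇w` with `‖∇u‖ ≥ m` outside a set `E` of measure at
most `κ + ε`, on which `∇u = (x, 0)` and `rot ∇w = (y, 0)`. -/
def StaircaseState (θ m x y κ : ℝ) : Prop :=
  ∃ B : ℝ, ∀ ε : ℝ, 0 < ε → ∃ (u w : Plane → ℝ) (E X : Set Plane),
    ContDiff ℝ 1 u ∧ HasCompactSupport u ∧ tsupport u ⊆ Metric.ball 0 1 ∧ ContDiff ℝ 1 w ∧
    (∀ z, ‖∇ u z‖ ≤ B) ∧ (∀ z, ‖∇ w z‖ ≤ B) ∧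
    MeasurableSet E ∧ MeasurableSet X ∧ E ⊆ Metric.ball 0 1 ∧ X ⊆ Metric.ball 0 1 ∧
    volume.real E ≤ κ + ε ∧ volume.real X ≤ ε ∧
    (∀ z ∈ E, ∇ u z = EuclideanSpace.single 0 x ∧ ∇ w z = EuclideanSpace.single 1 y) ∧
    ∀ z ∈ Metric.ball (0 : Plane) 1, z ∉ E → z ∉ X →
      oscField θ (∇ u z) = quarterTurn (∇ w z) ∧ m ≤ ‖∇ u z‖

/-- The initial state: `u = 0` and `w` linear, with the whole disc bad. No boundary condition is
imposed on `w`, so `rot ∇w` may be constant. -/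
theorem staircaseState_zero (θ m y : ℝ) :
    StaircaseState θ m 0 y (volume.real (Metric.ball (0 : Plane) 1)) := by
  have hg : ∀ z : Plane, HasGradientAt (fun z : Plane => y * z 1) (EuclideanSpace.single 1 y) z :=
    fun z => by
      rw [hasGradientAt_iff_hasFDerivAt]
      refine ((hasGradientAt_coord 1 z).hasFDerivAt.const_mul y).congr_fderiv ?_
      ext v
      simp [EuclideanSpace.inner_single_left]
  refine ⟨|y|, fun ε hε => ⟨fun _ => 0, fun z => y * z 1, Metric.ball 0 1, ∅, contDiff_const,
    HasCompactSupport.zero, ?_, by fun_prop, fun z => ?_, fun z => ?_, measurableSet_ball,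
    MeasurableSet.empty, subset_rfl, Set.empty_subset _, by linarith, by simpa using hε.le,
    fun z _ => ⟨?_, (hg z).gradient⟩, fun z hz hz' => absurd hz hz'⟩⟩
  · have : tsupport (fun _ : Plane => (0 : ℝ)) = ∅ := by
      rw [tsupport_eq_empty_iff]; rfl
    rw [this]
    exact Set.empty_subset _
  · simp
  · rw [(hg z).gradient, PiLp.norm_single, Real.norm_eq_abs]
  · rw [gradient_fun_const]
    exact (PiLp.single_eq_zero_iff ..).2 rfl |>.symm

/-- Splitting the first component of `∇u` into a good value `g` and a new bad value `x'`. -/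
theorem StaircaseState.horizontal {θ m x y κ : ℝ} (h : StaircaseState θ m x y κ) {g x' l : ℝ}
    (hl0 : 0 ≤ l) (hl1 : l ≤ 1) (hl : l * (x' - x) + (1 - l) * (g - x) = 0)
    (hg : oscScalar θ g = y) (hm : m ≤ |g|) : StaircaseState θ m x' y (l * κ) := by
  obtain ⟨B, hB⟩ := h
  refine ⟨B + (|x' - x| + |g - x| + 1), fun ε hε => ?_⟩
  obtain ⟨u, w, E, X, hu, huc, hus, hw, huB, hwB, hE, hX, hEs, hXs, hEv, hXv, hEe, hgood⟩ :=
    hB (ε / 2) (by positivity)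
  -- Adding `v` to `u` shifts `x` to `x'` on `E₁` and to the good value `g` on `E₂`; `hl` says that
  -- the shifts average to zero. The old state and the oscillation each cost `ε / 2`.
  obtain ⟨v, E₁, E₂, D, hv, hvc, hvs, hvB, hE₁, hD, hE₁E, hE₂E, hDs, hcov, hDv, hE₁v, hve₁, hve₂,
    hv0⟩ := exists_two_valued_gradient Metric.isOpen_ball (by finiteness) hE hEs (0 : Fin 2)
      hl0 hl1 hl (half_pos hε)
  refine ⟨fun z => u z + v z, w, E₁, X ∪ D, hu.add hv, huc.add hvc, ?_, hw, fun z => ?_,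
    fun z => (hwB z).trans (by linarith [abs_nonneg (x' - x), abs_nonneg (g - x)]), hE₁,
    hX.union hD, hE₁E.trans hEs, Set.union_subset hXs hDs, ?_, ?_, fun z hz => ?_,
    fun z hz hz₁ hzX => ?_⟩
  · exact (tsupport_add u v).trans (Set.union_subset hus hvs)
  · rw [gradient_add_of_contDiff hu hv]
    exact (norm_add_le _ _).trans (add_le_add (huB z) (hvB z))
  · nlinarith
  · exact (measureReal_union_le _ _).trans (by linarith)
  · rw [gradient_add_of_contDiff hu hv, hve₁ z hz, (hEe z (hE₁E hz)).1, ← PiLp.single_add]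
    exact ⟨by simp, (hEe z (hE₁E hz)).2⟩
  · rw [Set.mem_union, not_or] at hzX
    rw [gradient_add_of_contDiff hu hv]
    by_cases hzE : z ∈ E
    · have hz₂ : z ∈ E₂ := by
        rcases hcov hzE with (h | h) | h
        · exact absurd h hz₁
        · exact h
        · exact absurd h hzX.2
      rw [hve₂ z hz₂, (hEe z hzE).1, (hEe z hzE).2, ← PiLp.single_add, add_sub_cancel,
        oscField_single_zero, quarterTurn_single_one, hg, PiLp.norm_single, Real.norm_eq_abs]
      exact ⟨rfl, hm⟩
    · rw [hv0 z (by rintro ((h | h) | h); exacts [hz₁ h, hzE (hE₂E h), hzX.2 h]), add_zero]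
      exact hgood z hz hzE hzX.1

/-- Splitting the second component of `∇w` into the good value and a new bad value `y'`. -/
theorem StaircaseState.vertical {θ m x y κ : ℝ} (h : StaircaseState θ m x y κ) {y' l : ℝ}
    (hl0 : 0 ≤ l) (hl1 : l ≤ 1) (hl : l * (y' - y) + (1 - l) * (oscScalar θ x - y) = 0)
    (hm : m ≤ |x|) : StaircaseState θ m x y' (l * κ) := by
  obtain ⟨B, hB⟩ := h
  refine ⟨B + (|y' - y| + |oscScalar θ x - y| + 1), fun ε hε => ?_⟩
  obtain ⟨u, w, E, X, hu, huc, hus, hw, huB, hwB, hE, hX, hEs, hXs, hEv, hXv, hEe, hgood⟩ :=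
    hB (ε / 2) (by positivity)
  -- The oscillation of `w` is along the second axis, which `quarterTurn` maps to the first, so `rot
  -- ∇w` keeps the form `(y, 0)` on `E₁` and `E₂`.
  obtain ⟨v, E₁, E₂, D, hv, hvc, hvs, hvB, hE₁, hD, hE₁E, hE₂E, hDs, hcov, hDv, hE₁v, hve₁, hve₂,
    hv0⟩ := exists_two_valued_gradient Metric.isOpen_ball (by finiteness) hE hEs (1 : Fin 2)
      hl0 hl1 hl (half_pos hε)
  refine ⟨u, fun z => w z + v z, E₁, X ∪ D, hu, huc, hus, hw.add hv,
    fun z => (huB z).trans (by linarith [abs_nonneg (y' - y), abs_nonneg (oscScalar θ x - y)]),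
    fun z => ?_, hE₁, hX.union hD, hE₁E.trans hEs, Set.union_subset hXs hDs, ?_, ?_,
    fun z hz => ?_, fun z hz hz₁ hzX => ?_⟩
  · rw [gradient_add_of_contDiff hw hv]
    exact (norm_add_le _ _).trans (add_le_add (hwB z) (hvB z))
  · nlinarith
  · exact (measureReal_union_le _ _).trans (by linarith)
  · rw [gradient_add_of_contDiff hw hv, hve₁ z hz, (hEe z (hE₁E hz)).2, ← PiLp.single_add]
    exact ⟨(hEe z (hE₁E hz)).1, by simp⟩
  · rw [Set.mem_union, not_or] at hzX
    rw [gradient_add_of_contDiff hw hv]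
    by_cases hzE : z ∈ E
    · have hz₂ : z ∈ E₂ := by
        rcases hcov hzE with (h | h) | h
        · exact absurd h hz₁
        · exact h
        · exact absurd h hzX.2
      rw [hve₂ z hz₂, (hEe z hzE).1, (hEe z hzE).2, ← PiLp.single_add, add_sub_cancel,
        oscField_single_zero, quarterTurn_single_one, PiLp.norm_single, Real.norm_eq_abs]
      exact ⟨rfl, hm⟩
    · rw [hv0 z (by rintro ((h | h) | h); exacts [hz₁ h, hzE (hE₂E h), hzX.2 h]), add_zero]
      exact hgood z hz hzE hzX.1

theorem StaircaseState.mono {θ m x y κ κ' : ℝ} (h : StaircaseState θ m x y κ) (hκ : κ ≤ κ') :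
    StaircaseState θ m x y κ' := by
  obtain ⟨B, hB⟩ := h
  refine ⟨B, fun ε hε => ?_⟩
  obtain ⟨u, w, E, X, h1, h2, h3, h4, h5, h6, h7, h8, h9, h10, h11, h12⟩ := hB ε hε
  exact ⟨u, w, E, X, h1, h2, h3, h4, h5, h6, h7, h8, h9, h10, h11.trans (by linarith), h12⟩

/-! ### Decay of the bad set along the staircase -/

theorem oscScalar_natCast (θ : ℝ) (n : ℕ) : oscScalar θ n = n := by
  rw [oscScalar, mul_comm Real.pi, Real.sin_nat_mul_pi]
  simp

/-- At these points the sine equals `-1`, which gives the smallest factor `1 - √θ`. Evenness of `L`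
is required so that this applies at every height `L * n`. -/
theorem oscScalar_neg_even_add_half (θ : ℝ) {n : ℕ} (hn : Even n) :
    oscScalar θ (-(n + 1 / 2)) = -((1 - Real.sqrt θ) * (n + 1 / 2)) := by
  obtain ⟨k, rfl⟩ := hn
  have : Real.pi * -(((k + k : ℕ) : ℝ) + 1 / 2) = -(Real.pi / 2 + k * (2 * Real.pi)) := by
    push_cast; ring
  rw [oscScalar, this, Real.sin_neg, Real.sin_add_nat_mul_two_pi, Real.sin_pi_div_two]
  ring

/-- The staircase: the bad state at height `n` has measure decaying like `n ^ (-q)`. -/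
theorem staircaseState_nat {θ : ℝ} (hθ1 : θ < 1) {L : ℕ} (hL0 : 0 < L) (hL : Even L) {M : ℕ}
    (hM : 0 < M) {q : ℝ} (hq0 : 0 ≤ q)
    (hq : q ≤ 1 - 1 / (1 + (L : ℝ)) + 1 / (1 + (L : ℝ) * (1 - Real.sqrt θ))) (n : ℕ)
    (hn : M ≤ n) :
    StaircaseState θ M (-((L * n : ℕ) + 1 / 2)) n
      (volume.real (Metric.ball (0 : Plane) 1) * (((M : ℝ) + 2) / (n + 2)) ^ q) := by
  have hk : Real.sqrt θ ≤ 1 := Real.sqrt_le_one.2 hθ1.le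
  set k := 1 - Real.sqrt θ with hkdef
  have hk0 : 0 ≤ k := by linarith
  have hk1 : k ≤ 1 := by linarith [Real.sqrt_nonneg θ]
  have hL1 : (1 : ℝ) ≤ L := by exact_mod_cast hL0
  have hM1 : (1 : ℝ) ≤ M := by exact_mod_cast hM
  induction n, hn using Nat.le_induction with
  | base =>
    -- The gain in measure from this first split is discarded, since the claimed bound at `n = M` is
    -- the full area of the disc.
    have h := (staircaseState_zero θ M M).horizontal (g := M) (x' := -((L * M : ℕ) + 1 / 2))
      (l := M / (M + ((L * M : ℕ) + 1 / 2))) (by positivity)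
      (by rw [div_le_one (by positivity), le_add_iff_nonneg_right]; positivity)
      (by field_simp; ring) (oscScalar_natCast θ M) (le_abs_self _)
    refine h.mono ?_
    rw [div_self (by positivity), Real.one_rpow, mul_one]
    refine mul_le_of_le_one_left measureReal_nonneg ?_
    rw [div_le_one (by positivity), le_add_iff_nonneg_right]; positivity
  | succ n hn ih =>
    have hn1 : (1 : ℝ) ≤ n := hM1.trans (by exact_mod_cast hn)
    have hMn : (M : ℝ) ≤ n := by exact_mod_cast hn
    set x : ℝ := (L * n : ℕ) + 1 / 2 with hx
    set x' : ℝ := (L * (n + 1) : ℕ) + 1 / 2 with hx'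
    have hxe : x = L * n + 1 / 2 := by rw [hx]; push_cast; ring
    have hxe' : x' = x + L := by rw [hx, hx']; push_cast; ring
    have hx0 : 0 < x := by positivity
    have hx0' : 0 < x' := by positivity
    have hosc : oscScalar θ (-x') = -(k * x') :=
      oscScalar_neg_even_add_half θ (hL.mul_right (n + 1))
    -- The good endpoint is `(n, n)`; the new bad endpoint `-x'` gets the weight `(n + x) / (n +
    -- x')` by the lever rule.
    have h1 := ih.horizontal (g := n) (x' := -x') (l := (n + x) / (n + x')) (by positivity)
      (by rw [div_le_one (by positivity)]; linarith)
      (by field_simp; ring) (oscScalar_natCast θ n) (hMn.trans (le_abs_self _))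
    -- The good endpoint is `-k x'`, at distance `n + k x'` below the level `n`; the new bad level
    -- `n + 1` is at distance `1` above.
    have h2 := h1.vertical (y' := (n + 1 : ℕ)) (l := (n + k * x') / (n + 1 + k * x'))
      (by positivity) (by rw [div_le_one (by positivity)]; linarith)
      (by rw [hosc]; push_cast; field_simp; ring)
      (by rw [abs_neg, abs_of_pos hx0']; nlinarith)
    refine h2.mono ?_
    -- The weight is `1 - L / (n + x')`, with `n + x' ≤ (1 + L) (n + 2)`. The shift `n + 2` absorbs
    -- the half-integer terms, here and in `hβ`.
    have hα : (n + x) / (n + x') ≤ Real.exp (-((1 - 1 / (1 + (L : ℝ))) / (n + 2))) := by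
      refine le_trans ?_ (Real.add_one_le_exp _)
      rw [hxe', hxe]
      have : (1 - 1 / (1 + (L : ℝ))) / (n + 2) = L / ((1 + L) * (n + 2)) := by
        field_simp; ring
      rw [this]
      have : (n + (L * n + 1 / 2)) / (n + (L * n + 1 / 2 + L)) =
          -(L / (n + (L * n + 1 / 2 + L) : ℝ)) + 1 := by field_simp; ring
      rw [this]
      gcongr
      nlinarith
    have hβ : (n + k * x') / (n + 1 + k * x') ≤
        Real.exp (-((1 / (1 + (L : ℝ) * k)) / (n + 2))) := by
      refine le_trans ?_ (Real.add_one_le_exp _)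
      have : (1 / (1 + (L : ℝ) * k)) / (n + 2) = 1 / ((1 + L * k) * (n + 2)) := by
        field_simp
      rw [this]
      have : (n + k * x') / (n + 1 + k * x') = -(1 / (n + 1 + k * x')) + 1 := by
        field_simp; ring
      rw [this]
      gcongr
      rw [hxe', hxe]
      nlinarith [mul_nonneg (by positivity : (0 : ℝ) ≤ L) hk0]
    have hstep : (n + k * x') / (n + 1 + k * x') * ((n + x) / (n + x')) ≤
        (((n : ℝ) + 2) / (n + 3)) ^ q := by
      calc (n + k * x') / (n + 1 + k * x') * ((n + x) / (n + x'))
          ≤ Real.exp (-((1 / (1 + (L : ℝ) * k)) / (n + 2))) *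
            Real.exp (-((1 - 1 / (1 + (L : ℝ))) / (n + 2))) :=
            mul_le_mul hβ hα (by positivity) (Real.exp_nonneg _)
        _ ≤ Real.exp (-(q / (n + 2))) := by
            rw [← Real.exp_add, Real.exp_le_exp, ← neg_add, neg_le_neg_iff, ← add_div]
            gcongr
            linarith
        -- By `log ((n + 3) / (n + 2)) ≤ 1 / (n + 2)`; the resulting ratios telescope.
        _ ≤ (((n : ℝ) + 2) / (n + 3)) ^ q := by
            rw [Real.rpow_def_of_pos (by positivity), Real.exp_le_exp]
            have := Real.log_le_sub_one_of_pos (show 0 < ((n : ℝ) + 3) / (n + 2) by positivity)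
            have e : ((n : ℝ) + 3) / (n + 2) - 1 = 1 / (n + 2) := by field_simp; ring
            rw [e, ← inv_div, Real.log_inv] at this
            have h3 : -(1 / ((n : ℝ) + 2)) * q ≤ Real.log (((n : ℝ) + 2) / (n + 3)) * q :=
              mul_le_mul_of_nonneg_right (by linarith) hq0
            refine le_trans (le_of_eq ?_) h3
            ring
    have htel : (((n : ℝ) + 2) / (n + 3)) ^ q * (((M : ℝ) + 2) / (n + 2)) ^ q =
        (((M : ℝ) + 2) / ((n + 1 : ℕ) + 2)) ^ q := by
      rw [← Real.mul_rpow (by positivity) (by positivity)]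
      congr 1
      push_cast
      field_simp
      ring
    rw [← htel]
    have hv : 0 ≤ volume.real (Metric.ball (0 : Plane) 1) := measureReal_nonneg
    have hp : 0 ≤ (((M : ℝ) + 2) / (n + 2)) ^ q := by positivity
    calc _ = ((n + k * x') / (n + 1 + k * x') * ((n + x) / (n + x'))) *
          ((((M : ℝ) + 2) / (n + 2)) ^ q * volume.real (Metric.ball (0 : Plane) 1)) := by ring
      _ ≤ (((n : ℝ) + 2) / (n + 3)) ^ q *
          ((((M : ℝ) + 2) / (n + 2)) ^ q * volume.real (Metric.ball (0 : Plane) 1)) := by gcongr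
      _ = _ := by ring

/-! ### Choice of parameters and conclusion -/

/-- Every exponent below the threshold lies below the decay rate of some staircase. -/
theorem exists_staircase_exponent {θ : ℝ} (hθ0 : 0 < θ) (hθ1 : θ < 1) {r : ℝ}
    (hr : r < thresholdExponent θ) :
    ∃ L : ℕ, 0 < L ∧ Even L ∧
      r < 1 - 1 / (1 + (L : ℝ)) + 1 / (1 + (L : ℝ) * (1 - Real.sqrt θ)) := by
  obtain ⟨s, ⟨L, hL0, hL, rfl⟩, hs⟩ := (lt_isLUB_iff (isLUB_thresholdExponent hθ1)).1 hr
  refine ⟨L, hL0, hL, hs.trans_le ?_⟩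
  have hk : Real.sqrt θ ≤ 1 := Real.sqrt_le_one.2 hθ1.le
  -- The staircase has `1 - √θ` where the threshold has `1 - θ`, so its exponent is at least as
  -- large.
  have hθs : θ ≤ Real.sqrt θ := Real.le_sqrt_of_sq_le (by nlinarith)
  have hL' : (0 : ℝ) ≤ L := Nat.cast_nonneg L
  have : 0 ≤ (L : ℝ) * (1 - Real.sqrt θ) := mul_nonneg hL' (by linarith)
  gcongr

/-- The left side bounds the share of the bad set in `∫ |F| ^ r`: size to the power `r` times
measure, a constant times `(n + 2) ^ (r - q)`. -/
theorem exists_staircase_height {r q C b m : ℝ} (hrq : r < q) (hC : 0 ≤ C) (hm : 0 ≤ m) (M : ℕ) :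
    ∃ n : ℕ, M ≤ n ∧ (C * (n + 2)) ^ r * (b * (m / (n + 2)) ^ q) ≤ 1 / 2 := by
  have hlim : Filter.Tendsto (fun n : ℕ => C ^ r * b * m ^ q * ((n : ℝ) + 2) ^ (-(q - r)))
      Filter.atTop (nhds (C ^ r * b * m ^ q * 0)) := by
    refine Filter.Tendsto.const_mul _ ((tendsto_rpow_neg_atTop (sub_pos.2 hrq)).comp ?_)
    exact Filter.tendsto_atTop_add_const_right _ _ tendsto_natCast_atTop_atTop
  rw [mul_zero] at hlim
  obtain ⟨n, hn, hMn⟩ := ((hlim.eventually_le_const (by norm_num : (0 : ℝ) < 1 / 2)).and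
    (Filter.eventually_ge_atTop M)).exists
  refine ⟨n, hMn, le_trans (le_of_eq ?_) hn⟩
  have hn0 : (0 : ℝ) < n + 2 := by positivity
  rw [Real.mul_rpow hC hn0.le, Real.div_rpow hm hn0.le, neg_sub, Real.rpow_sub hn0]
  ring

theorem theorem1p2 (θ : ℝ) (hθ0 : 0 < θ) (hθ1 : θ < 1) (Λ : ℝ) (hΛ : 0 < Λ)
    (r : ℝ) (hr1 : 1 < r) (hr2 : r < thresholdExponent θ) :
    ∃ (u : Plane → ℝ) (gradu F : Plane → Plane),
      (∃ K : NNReal, LipschitzOnWith K u (closure (unitDisc : Set Plane))) ∧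
      MemW1InftyZero unitDisc u gradu ∧
      MemLp F ∞ (volume.restrict (unitDisc : Set Plane)) ∧
      DivEqDiv unitDisc (fun x => oscField θ (gradu x)) F ∧
      (∫ x in (unitDisc : Set Plane), ‖gradu x‖ ^ r) >
        Λ * (1 + ∫ x in (unitDisc : Set Plane), ‖F x‖ ^ r) := by
  have hΩ : (unitDisc : Set Plane) = Metric.ball 0 1 := rfl
  have hr0 : 0 < r := by linarith
  obtain ⟨L, hL0, hL, hrL⟩ := exists_staircase_exponent hθ0 hθ1 hr2
  set q := 1 - 1 / (1 + (L : ℝ)) + 1 / (1 + (L : ℝ) * (1 - Real.sqrt θ)) with hq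
  set b := volume.real (Metric.ball (0 : Plane) 1) with hb
  have hb0 : 0 < b := ENNReal.toReal_pos (Metric.measure_ball_pos _ _ one_pos).ne' (by finiteness)
  obtain ⟨M, hM⟩ := exists_nat_gt (4 * Λ / b)
  have hM0' : (0 : ℝ) < M := lt_trans (by positivity) hM
  have hM0 : 0 < M := by exact_mod_cast hM0'
  have hM1 : (1 : ℝ) ≤ M := by exact_mod_cast hM0
  have hMr : 2 * Λ < (M : ℝ) ^ r * (b / 2) := by
    rw [div_lt_iff₀ hb0] at hM
    have : (M : ℝ) ≤ (M : ℝ) ^ r := Real.self_le_rpow_of_one_le hM1 hr1.le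
    nlinarith
  set C : ℝ := 2 * L + 1 with hC
  have hC0 : 0 ≤ C := by positivity
  obtain ⟨n, hMn, hn⟩ := exists_staircase_height (b := b) hrL hC0
    (show (0 : ℝ) ≤ M + 2 by positivity) M
  obtain ⟨B, hB⟩ := staircaseState_nat hθ1 hL0 hL hM0 (hr0.trans hrL).le le_rfl n hMn
  set a := (C * (n + 2)) ^ r with ha
  have ha0 : 0 ≤ a := by positivity
  -- The gradient bound `B` was fixed before `ε`, so `ε` may depend on it. The first entry leaves
  -- half of the disc outside `X`; the second makes the `ε` errors in `∫ |F| ^ r` at most `1 / 2`.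
  set ε := min (b / 2) (1 / (2 * (a + (3 * |B|) ^ r + 1))) with hε
  have hc0 : 0 ≤ (3 * |B|) ^ r := by positivity
  have hε0 : 0 < ε := lt_min (by positivity) (by positivity)
  have hεb : ε ≤ b / 2 := min_le_left _ _
  have hεa : a * ε + (3 * |B|) ^ r * ε ≤ 1 / 2 := by
    have h1 : ε ≤ 1 / (2 * (a + (3 * |B|) ^ r + 1)) := min_le_right _ _
    rw [le_div_iff₀ (by positivity)] at h1
    nlinarith
  obtain ⟨u, w, E, X, hu, huc, hus, hw, huB, hwB, hE, hX, hEs, hXs, hEv, hXv, hEe, hgood⟩ :=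
    hB ε hε0
  have hgu := continuous_gradient hu
  have hVc : Continuous fun z => quarterTurn (∇ w z) :=
    continuous_quarterTurn.comp (continuous_gradient hw)
  have hAc : Continuous fun z => oscField θ (∇ u z) := (continuous_oscField θ).comp hgu
  -- Zero off `E ∪ X`, at most `C (n + 2)` on `E`, and at most `3 |B|` on `X`.
  set F : Plane → Plane := fun z => oscField θ (∇ u z) - quarterTurn (∇ w z) with hF
  have hFc : Continuous F := hAc.sub hVc
  have hFB : ∀ z, ‖F z‖ ≤ 3 * |B| := fun z => by
    refine (norm_sub_le _ _).trans ?_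
    rw [norm_quarterTurn]
    linarith [norm_oscField_le hθ1.le (∇ u z), huB z, hwB z, le_abs_self B]
  have hFE : ∀ z ∈ E, ‖F z‖ ≤ C * (n + 2) := fun z hz => by
    refine (norm_sub_le _ _).trans ?_
    have h1 := norm_oscField_le hθ1.le (∇ u z)
    rw [norm_quarterTurn, (hEe z hz).2]
    rw [(hEe z hz).1] at h1 ⊢
    rw [PiLp.norm_single] at h1 ⊢
    rw [Real.norm_eq_abs, abs_neg, abs_of_nonneg (by positivity)] at h1
    rw [Real.norm_eq_abs, Nat.abs_cast]
    rw [Nat.cast_mul] at h1 ⊢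
    have : (0 : ℝ) ≤ L := Nat.cast_nonneg L
    rw [hC]
    linarith
  have hlip := hu.lipschitzWith_of_hasCompactSupport huc one_ne_zero
  obtain ⟨U, hU⟩ := huc.exists_bound_of_continuous hu.continuous
  have hcompact : IsCompact (Metric.closedBall (0 : Plane) 1) := isCompact_closedBall 0 1
  have hint : ∀ {G : Plane → Plane}, Continuous G →
      IntegrableOn (fun z => ‖G z‖ ^ r) (Metric.ball 0 1) := fun hG =>
    (((hG.norm.rpow_const fun _ => Or.inr hr0.le).continuousOn).integrableOn_compact
      hcompact).mono_set Metric.ball_subset_closedBall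
  refine ⟨u, ∇ u, F, ?_, ⟨⟨hasWeakGradient_gradient _ hu, ?_, ?_⟩, hu.continuous.continuousOn, ?_⟩,
    ?_, ⟨hAc.locallyIntegrable.locallyIntegrableOn _, hFc.locallyIntegrable.locallyIntegrableOn _,
      fun φ => ?_⟩, ?_⟩
  · obtain ⟨K, hK⟩ := hlip
    exact ⟨K, hK.lipschitzOnWith⟩
  · exact memLp_top_of_bound hu.continuous.aestronglyMeasurable U (Filter.Eventually.of_forall hU)
  · exact memLp_top_of_bound hgu.aestronglyMeasurable B (Filter.Eventually.of_forall huB)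
  · intro x hx
    refine image_eq_zero_of_notMem_tsupport fun h => ?_
    rw [hΩ, Metric.isOpen_ball.frontier_eq] at hx
    exact hx.2 (hus h)
  · exact memLp_top_of_bound hFc.aestronglyMeasurable _ (Filter.Eventually.of_forall hFB)
  · have hφ : ContDiff ℝ 1 (φ : Plane → ℝ) := φ.contDiff.of_le (by exact_mod_cast le_top)
    have hi : ∀ {G : Plane → Plane}, Continuous G → IntegrableOn
        (fun z => ⟪G z, ∇ (φ : Plane → ℝ) z⟫) (unitDisc : Set Plane) := fun hG =>
      ((hG.inner (continuous_gradient hφ)).integrable_of_hasCompactSupport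
        ((hasCompactSupport_gradient φ.hasCompactSupport).mono fun z hz h0 => hz (by
          simp only [h0, inner_zero_right]))).integrableOn
    simp only [hF, inner_sub_left]
    rw [integral_sub (hi hAc) (hi hVc), integral_inner_quarterTurn_gradient hw φ, sub_zero]
  · rw [hΩ, gt_iff_lt]
    have : IsFiniteMeasure (volume.restrict (Metric.ball (0 : Plane) 1)) :=
      ⟨by rw [Measure.restrict_apply_univ]; exact measure_ball_lt_top⟩
    have hupper : ∫ z in Metric.ball (0 : Plane) 1, ‖F z‖ ^ r ≤ 1 := by
      have hiE : Integrable (E.indicator fun _ => a)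
          (volume.restrict (Metric.ball (0 : Plane) 1)) := (integrable_const a).indicator hE
      have hiX : Integrable (X.indicator fun _ => (3 * |B|) ^ r)
          (volume.restrict (Metric.ball (0 : Plane) 1)) := (integrable_const _).indicator hX
      calc ∫ z in Metric.ball (0 : Plane) 1, ‖F z‖ ^ r
          ≤ ∫ z in Metric.ball (0 : Plane) 1, ((E.indicator fun _ => a) z +
              (X.indicator fun _ => (3 * |B|) ^ r) z) := by
            refine setIntegral_mono_on (hint hFc) (hiE.add hiX) measurableSet_ball fun z hz => ?_
            have hX0 : 0 ≤ (X.indicator fun _ => (3 * |B|) ^ r) z :=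
              Set.indicator_nonneg (fun _ _ => hc0) z
            by_cases hzE : z ∈ E
            · rw [Set.indicator_of_mem hzE]
              have := Real.rpow_le_rpow (norm_nonneg _) (hFE z hzE) hr0.le
              linarith
            · rw [Set.indicator_of_notMem hzE, zero_add]
              by_cases hzX : z ∈ X
              · rw [Set.indicator_of_mem hzX]
                exact Real.rpow_le_rpow (norm_nonneg _) (hFB z) hr0.le
              · have : F z = 0 := sub_eq_zero.2 (hgood z hz hzE hzX).1
                rw [this, norm_zero, Real.zero_rpow hr0.ne']
                exact hX0
        _ = a * volume.real E + (3 * |B|) ^ r * volume.real X := by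
            rw [integral_add hiE hiX, integral_indicator_const _ hE,
              integral_indicator_const _ hX, measureReal_restrict_apply hE,
              measureReal_restrict_apply hX, Set.inter_eq_left.2 hEs, Set.inter_eq_left.2 hXs,
              smul_eq_mul, smul_eq_mul, mul_comm a, mul_comm ((3 * |B|) ^ r)]
        _ ≤ a * (b * ((M + 2) / (n + 2)) ^ q + ε) + (3 * |B|) ^ r * ε := by gcongr
        _ ≤ 1 := by linarith
    have hlower : (M : ℝ) ^ r * (b / 2) ≤ ∫ z in Metric.ball (0 : Plane) 1, ‖∇ u z‖ ^ r := by
      have hm : MeasurableSet (Metric.ball (0 : Plane) 1 \ X) := measurableSet_ball.diff hX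
      have hfin : volume (Metric.ball (0 : Plane) 1 \ X) ≠ ⊤ :=
        ne_top_of_le_ne_top (by finiteness) (measure_mono Set.sdiff_subset)
      have hvol : b / 2 ≤ volume.real (Metric.ball (0 : Plane) 1 \ X) := by
        have := le_measureReal_sdiff (μ := volume) (s₁ := Metric.ball (0 : Plane) 1) (s₂ := X)
          (ne_top_of_le_ne_top (by finiteness) (measure_mono hXs))
        linarith
      calc (M : ℝ) ^ r * (b / 2) ≤ (M : ℝ) ^ r * volume.real (Metric.ball (0 : Plane) 1 \ X) := by
            gcongr
        _ ≤ ∫ z in Metric.ball (0 : Plane) 1 \ X, ‖∇ u z‖ ^ r := by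
            refine setIntegral_ge_of_const_le_real hm hfin (fun z hz => ?_)
              ((hint hgu).mono_set Set.sdiff_subset)
            refine Real.rpow_le_rpow hM0'.le ?_ hr0.le
            -- The bad set also counts here: on it `|∇u| = L n + 1/2 ≥ M`. Only `X` is lost.
            by_cases hzE : z ∈ E
            · rw [(hEe z hzE).1, PiLp.norm_single, Real.norm_eq_abs, abs_neg,
                abs_of_nonneg (by positivity)]
              have : M ≤ L * n := hMn.trans (Nat.le_mul_of_pos_left n hL0)
              have : (M : ℝ) ≤ (L * n : ℕ) := by exact_mod_cast this
              linarith
            · exact (hgood z hz.1 hzE hz.2).2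
        _ ≤ ∫ z in Metric.ball (0 : Plane) 1, ‖∇ u z‖ ^ r :=
            setIntegral_mono_set (hint hgu)
              (Filter.Eventually.of_forall fun z => by positivity) Set.sdiff_subset.eventuallyLE
    have : Λ * (1 + ∫ z in Metric.ball (0 : Plane) 1, ‖F z‖ ^ r) ≤ Λ * 2 := by
      gcongr
      linarith
    linarith

end
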